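/- Let $(X,d)$ be a compact metric space and $T:X\to X$ a continuous map. Write $\mathbb N=\{0,1,2,\dots\}$, $\mathbb N^+=\{1,2,\dots\}$. $(X,T)$ has the approximate product property if for all $\varepsilon,\delta_1,\delta_2>0$ there is $N\in\mathbb N^+$ such that for every $n\ge N$ and every sequence $(x_i)_{i\ge1}$ in $X$ there are integers $(h_i)_{i\ge1}$ and a point $z\in X$ with $h_1=0$ and, for every $i\ge 1$, $n\le h_{i+1}-h_i\le n(1+\delta_2)$ and $\#\{0\le j\le n-1: d(T^{h_i+j}z,T^jx_i)\ge\varepsilon\}\le\delta_1 n$. The measure center $C_T(X)$ is the closure of the union of the supports of all $T$-invariant Borel probability measures on $X$. $(X,T)$ is transitive if for all nonempty open $U,V\subseteq X$ there is $n\in\mathbb N$ with $U\cap T^{-n}V\ne\emptyset$. Let $m(\varepsilon,x,y,n),g(\varepsilon,x,y,n)\in\mathbb N$ be functions of $\varepsilon>0$, $x,y\in X$, $n\in\mathbb N^+$ with $g(\varepsilon,x,y,n)\le n$. $(X,T)$ is $m$-$g$-transitive if it is transitive and for every $\varepsilon>0$ and $x_1,x_2\in X$ there is $N\in\mathbb N^+$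 such that for every $n\ge N$ there are $z\in X$, $p\in\mathbb N$ and $\Lambda\subseteq\{0,\dots,n-1\}$ with $p\le m(\varepsilon,x_1,x_2,n)$, $\#(\{0,\dots,n-1\}\setminus\Lambda)\le g(\varepsilon,x_1,x_2,n)$, $d(z,x_1)<\varepsilon$, and $d(T^{p+j}z,T^jx_2)<\varepsilon$ for all $j\in\Lambda$. Theorem. Suppose that $(X,T)$ has the approximate product property and $C_T(X)=X$. Then there exist functions $m,g$ as above such that $(X,T)$ is $m$-$g$-transitive and $$\lim_{n\to\infty}\frac{m(\varepsilon,x,y,n)+g(\varepsilon,x,y,n)}{n}=0\qquad\text{for every }\varepsilon>0\text{ and all }x,y\in X.$$ -/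

import Mathlib

open Filter Topology MeasureTheory

namespace TopDyn

/-- Topological transitivity: every nonempty open `U` meets some preimage `T⁻ⁿ V` (`n ≥ 0`) of
every nonempty open `V`. -/
def IsTransitive {X : Type*} [TopologicalSpace X] (T : X → X) : Prop :=
  ∀ U V : Set X, IsOpen U → U.Nonempty → IsOpen V → V.Nonempty →
    ∃ n : ℕ, (U ∩ T^[n] ⁻¹' V).Nonempty

/-- The measure center: the closure of the union of the supports of all `T`-invariant Borel
probability measures. -/
def measureCenter {X : Type*} [TopologicalSpace X] [MeasurableSpace X] (T : X → X) : Set X :=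
  closure (⋃ μ ∈ {μ : Measure X | IsProbabilityMeasure μ ∧ MeasurePreserving T μ μ}, μ.support)

/-- The approximate product property. Sequences are indexed from `0` instead of `1`; the integers
`h i` are automatically nonnegative, since they start at `0` and increase. -/
def ApproximateProductProperty {X : Type*} [MetricSpace X] (T : X → X) : Prop :=
  ∀ ε δ₁ δ₂ : ℝ, 0 < ε → 0 < δ₁ → 0 < δ₂ →
    ∃ N : ℕ, 0 < N ∧ ∀ n : ℕ, N ≤ n → ∀ x : ℕ → X,
      ∃ (h : ℕ → ℕ) (z : X), h 0 = 0 ∧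
        ∀ i : ℕ, h i + n ≤ h (i + 1) ∧ (h (i + 1) : ℝ) - (h i : ℝ) ≤ (n : ℝ) * (1 + δ₂) ∧
          (((Finset.range n).filter
            (fun j => ε ≤ dist (T^[h i + j] z) (T^[j] (x i)))).card : ℝ) ≤ δ₁ * (n : ℝ)

/-- The `m`-`g`-product property, for gap functions `m(ε, x, y, n)` and `g(ε, x, y, n)`; only the
values at `ε > 0` and `n ≥ 1` matter. -/
def MGProductProperty {X : Type*} [MetricSpace X] (T : X → X)
    (m g : ℝ → X → X → ℕ → ℕ) : Prop :=
  ∀ ε : ℝ, 0 < ε → ∀ x₁ x₂ : X, ∃ N : ℕ, 0 < N ∧ ∀ n : ℕ, N ≤ n →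
    ∃ (z : X) (p : ℕ) (Λ : Finset ℕ), Λ ⊆ Finset.range n ∧ p ≤ m ε x₁ x₂ n ∧
      (Finset.range n \ Λ).card ≤ g ε x₁ x₂ n ∧
      dist z x₁ < ε ∧ ∀ j ∈ Λ, dist (T^[p + j] z) (T^[j] x₂) < ε

/-- `m`-`g`-transitivity: the `m`-`g`-product property together with transitivity. -/
def MGTransitive {X : Type*} [MetricSpace X] (T : X → X)
    (m g : ℝ → X → X → ℕ → ℕ) : Prop :=
  MGProductProperty T m g ∧ IsTransitive T

end TopDyn

namespace TopDyn

/-! Full measure center gives an invariant measure of mass `c > 0` on a ball about `x₁`. Averaging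
visits over a short window at the end of `[0, n)` yields a point `w` that hits the ball in a
proportion at least `c` of the window. A point following `w` and then `x₂`, with fewer mistakes than
these hits, is near `x₁` at some hit; started there, it reaches the `x₂` block after a gap of at
most `κ * n`. Since `κ` is arbitrary, the least admissible bound is `o(n)`. -/

/-- Averaging over an invariant measure: some orbit visits `B` along the times in `S` at least as
often as the measure of `B` predicts. -/
theorem exists_card_visits_ge {X : Type*} [MeasurableSpace X] {T : X → X} {μ : Measure X}
    [IsProbabilityMeasure μ] (hμ : MeasurePreserving T μ μ) {B : Set X} (hB : MeasurableSet B)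
    (S : Finset ℕ) :
    ∃ w : X, ∃ F ⊆ S, (∀ j ∈ F, T^[j] w ∈ B) ∧ μ.real B * S.card ≤ (F.card : ℝ) := by
  classical
  have hm : ∀ j : ℕ, MeasurableSet (T^[j] ⁻¹' B) := fun j => (hμ.iterate j).measurable hB
  have hint : ∀ j ∈ S, Integrable ((T^[j] ⁻¹' B).indicator (1 : X → ℝ)) μ :=
    fun j _ => (integrable_const (1 : ℝ)).indicator (hm j)
  obtain ⟨w, hw⟩ := exists_integral_le (integrable_finsetSum S hint)
  refine ⟨w, S.filter (fun j => T^[j] w ∈ B), Finset.filter_subset _ _,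
    fun j hj => (Finset.mem_filter.1 hj).2, ?_⟩
  rw [integral_finsetSum S hint] at hw
  have hval : ∀ j ∈ S, ∫ x, (T^[j] ⁻¹' B).indicator (1 : X → ℝ) x ∂μ = μ.real B := fun j _ => by
    rw [integral_indicator_one (hm j), Measure.real,
      (hμ.iterate j).measure_preimage hB.nullMeasurableSet, Measure.real]
  rw [Finset.sum_congr rfl hval, Finset.sum_const, nsmul_eq_mul, mul_comm] at hw
  refine hw.trans (le_of_eq ?_)
  rw [Finset.card_filter, Nat.cast_sum]
  refine Finset.sum_congr rfl fun j _ => ?_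
  by_cases h : T^[j] w ∈ B <;> simp [Set.indicator, h]

/-- If the measure center is everything, each ball is charged by some invariant measure. -/
theorem exists_invariant_measure_ball_pos {X : Type*} [MetricSpace X] [MeasurableSpace X]
    {T : X → X} (hcenter : measureCenter T = Set.univ) (x : X) {r : ℝ} (hr : 0 < r) :
    ∃ μ : Measure X, IsProbabilityMeasure μ ∧ MeasurePreserving T μ μ ∧
      0 < μ.real (Metric.ball x r) := by
  have hx : x ∈ measureCenter T := hcenter ▸ Set.mem_univ x
  obtain ⟨y, hy, hyU⟩ := mem_closure_iff.1 hx _ Metric.isOpen_ball (Metric.mem_ball_self hr)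
  simp only [Set.mem_iUnion, Set.mem_ofPred_eq] at hyU
  obtain ⟨μ, ⟨hp, hinv⟩, hsupp⟩ := hyU
  have hpos := (Measure.mem_support_iff_forall y).1 hsupp _ (Metric.isOpen_ball.mem_nhds hy)
  exact ⟨μ, hp, hinv, ENNReal.toReal_pos hpos.ne' (measure_ne_top _ _)⟩

/-- The approximate product property together with full measure center lets one start near `x₁`
and, after a gap of at most `κ * n`, follow the first `n` steps of any orbit up to `κ * n`
mistakes. -/
theorem exists_shadowing_from_ball {X : Type*} [MetricSpace X] [MeasurableSpace X]
    [BorelSpace X] {T : X → X} (happ : ApproximateProductProperty T)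
    (hcenter : measureCenter T = Set.univ) {ε κ : ℝ} (hε : 0 < ε) (hκ : 0 < κ) (x₁ : X) :
    ∃ N : ℕ, 0 < N ∧ ∀ n : ℕ, N ≤ n → ∀ x₂ : X, ∃ (z : X) (p : ℕ) (Λ : Finset ℕ),
      Λ ⊆ Finset.range n ∧ (p : ℝ) ≤ κ * n ∧ ((Finset.range n \ Λ).card : ℝ) ≤ κ * n ∧
      dist z x₁ < ε ∧ ∀ j ∈ Λ, dist (T^[p + j] z) (T^[j] x₂) < ε := by
  classical
  -- This lets a window of length about `κ * n / 2` fit inside `[0, n)`.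
  wlog hκ1 : κ ≤ 1 generalizing κ
  · obtain ⟨N, hN, h⟩ := this one_pos le_rfl
    refine ⟨N, hN, fun n hn x₂ => ?_⟩
    obtain ⟨z, p, Λ, h1, h2, h3, h4⟩ := h n hn x₂
    have : (1 : ℝ) * n ≤ κ * n := by gcongr; exact (not_le.1 hκ1).le
    exact ⟨z, p, Λ, h1, h2.trans this, h3.trans this, h4⟩
  obtain ⟨μ, hp, hinv, hc⟩ := exists_invariant_measure_ball_pos hcenter x₁ (half_pos hε)
  set c := μ.real (Metric.ball x₁ (ε / 2)) with hcdef
  have hc1 : c ≤ 1 := measureReal_le_one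
  -- Half of the gap budget `κ` pays for the window, half for the slack in `h 1`. Once `κ * n ≥ 4`,
  -- the window length exceeds `κ / 8 * n`, so the mistakes number less than `c * k`.
  obtain ⟨N, hN, happN⟩ := happ (ε / 2) (c * κ / 8) (κ / 2) (half_pos hε) (by positivity)
    (by positivity)
  refine ⟨max N ⌈4 / κ⌉₊, lt_max_of_lt_left hN, fun n hn x₂ => ?_⟩
  have hnκ : 4 ≤ κ * n := by
    have h1 : 4 / κ ≤ (n : ℝ) :=
      (Nat.le_ceil _).trans (by exact_mod_cast (le_max_right _ _).trans hn)
    rwa [div_le_iff₀' hκ] at h1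
  set k := ⌊κ / 2 * n⌋₊ with hk
  have hk1 : (k : ℝ) ≤ κ / 2 * n := Nat.floor_le (by positivity)
  have hk2 : κ / 2 * n < k + 1 := Nat.lt_floor_add_one _
  have hn0 : (0 : ℝ) ≤ n := n.cast_nonneg
  have hkn : k ≤ n := by
    have : (k : ℝ) ≤ n := by nlinarith
    exact_mod_cast this
  obtain ⟨w, F, hFS, hFB, hF⟩ := exists_card_visits_ge hinv
    (Metric.isOpen_ball (x := x₁) (ε := ε / 2)).measurableSet (Finset.Ico (n - k) n)
  rw [Nat.card_Ico, Nat.sub_sub_self hkn, ← hcdef] at hF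
  -- Only blocks `0` and `1` are used.
  obtain ⟨h, y, h0, hy⟩ := happN n ((le_max_left _ _).trans hn) (fun i => if i = 0 then w else x₂)
  obtain ⟨hgap, hgap', herr⟩ := hy 0
  have herr' := (hy 1).2.2
  simp only [h0, zero_add, if_true, one_ne_zero, if_false, Nat.cast_zero, sub_zero]
    at hgap hgap' herr herr'
  have hlt : ((Finset.range n).filter
      (fun j => ε / 2 ≤ dist (T^[j] y) (T^[j] w))).card < F.card := by
    have : c * κ / 8 * n < c * k := by
      have : κ / 8 * n < k := by linarith
      nlinarith
    exact_mod_cast herr.trans_lt (this.trans_le hF)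
  obtain ⟨j, hjF, hj⟩ := Finset.exists_mem_notMem_of_card_lt_card hlt
  obtain ⟨hj1, hj2⟩ := Finset.mem_Ico.1 (hFS hjF)
  have hclose : dist (T^[j] y) (T^[j] w) < ε / 2 := by
    by_contra hcon
    exact hj (Finset.mem_filter.2 ⟨Finset.mem_range.2 hj2, not_lt.1 hcon⟩)
  have hjh : j ≤ h 1 := hj2.le.trans hgap
  refine ⟨T^[j] y, h 1 - j, (Finset.range n).filter
    (fun i => dist (T^[h 1 + i] y) (T^[i] x₂) < ε / 2), Finset.filter_subset _ _, ?_, ?_, ?_, ?_⟩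
  · have : (n : ℝ) ≤ j + k := by exact_mod_cast (by omega : n ≤ j + k)
    rw [Nat.cast_sub hjh]
    linarith
  · rw [← Finset.filter_not]
    simp only [not_lt]
    refine herr'.trans ?_
    gcongr
    nlinarith
  · have := hFB j hjF
    rw [Metric.mem_ball] at this
    linarith [dist_triangle (T^[j] y) (T^[j] w) x₁]
  · intro i hi
    rw [← Function.iterate_add_apply, show h 1 - j + i + j = h 1 + i by omega]
    linarith [(Finset.mem_filter.1 hi).2]

/-- The point to follow is chosen to visit a ball inside `V` at least `c * N` times; at most `c / 2
* N` mistakes cannot spoil every visit. -/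
theorem isTransitive_of_approximateProductProperty {X : Type*} [MetricSpace X]
    [MeasurableSpace X] [BorelSpace X] {T : X → X} (happ : ApproximateProductProperty T)
    (hcenter : measureCenter T = Set.univ) : IsTransitive T := by
  intro U V hU ⟨x, hx⟩ hV ⟨y, hy⟩
  obtain ⟨r, hr, hrU⟩ := Metric.isOpen_iff.1 hU x hx
  obtain ⟨s, hs, hsV⟩ := Metric.isOpen_iff.1 hV y hy
  obtain ⟨μ, hp, hinv, hc⟩ := exists_invariant_measure_ball_pos hcenter y (half_pos hs)
  obtain ⟨N, hN, h⟩ := exists_shadowing_from_ball happ hcenter (lt_min hr (half_pos hs))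
    (half_pos hc) x
  obtain ⟨w, F, hFS, hFB, hF⟩ := exists_card_visits_ge hinv
    (Metric.isOpen_ball (x := y) (ε := s / 2)).measurableSet (Finset.range N)
  obtain ⟨z, p, Λ, -, -, hΛ, hz, htrace⟩ := h N le_rfl w
  rw [Finset.card_range] at hF
  have hlt : (Finset.range N \ Λ).card < F.card := by
    have hN' : (0 : ℝ) < N := by exact_mod_cast hN
    have : ((Finset.range N \ Λ).card : ℝ) < F.card := by nlinarith [mul_pos hc hN']
    exact_mod_cast this
  obtain ⟨j, hjF, hj⟩ := Finset.exists_mem_notMem_of_card_lt_card hlt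
  have hjΛ : j ∈ Λ := by
    by_contra hcon
    exact hj (Finset.mem_sdiff.2 ⟨hFS hjF, hcon⟩)
  refine ⟨p + j, z, hrU (hz.trans_le (min_le_left _ _)), hsV ?_⟩
  have h1 := (htrace j hjΛ).trans_le (min_le_right _ _)
  have h2 := hFB j hjF
  rw [Metric.mem_ball] at h2 ⊢
  linarith [dist_triangle (T^[p + j] z) (T^[j] w) y]

/-- The numbers `a` that bound both the gap and the mistakes of some orbit starting `ε`-close to
`x` and `ε`-following the first `n` steps of `y`. -/
def gapBounds {X : Type*} [MetricSpace X] (T : X → X) (ε : ℝ) (x y : X) (n : ℕ) : Set ℕ :=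
  {a | ∃ (z : X) (p : ℕ) (Λ : Finset ℕ), Λ ⊆ Finset.range n ∧ p ≤ a ∧
    (Finset.range n \ Λ).card ≤ a ∧ dist z x < ε ∧ ∀ j ∈ Λ, dist (T^[p + j] z) (T^[j] y) < ε}

theorem eventually_floor_mem_gapBounds {X : Type*} [MetricSpace X] [MeasurableSpace X]
    [BorelSpace X] {T : X → X} (happ : ApproximateProductProperty T)
    (hcenter : measureCenter T = Set.univ) {ε κ : ℝ} (hε : 0 < ε) (hκ : 0 < κ) (x y : X) :
    ∃ N : ℕ, 0 < N ∧ ∀ n : ℕ, N ≤ n → ⌊κ * n⌋₊ ∈ gapBounds T ε x y n := by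
  obtain ⟨N, hN, h⟩ := exists_shadowing_from_ball happ hcenter hε hκ x
  refine ⟨N, hN, fun n hn => ?_⟩
  obtain ⟨z, p, Λ, h1, h2, h3, h4⟩ := h n hn y
  exact ⟨z, p, Λ, h1, Nat.le_floor h2, Nat.le_floor h3, h4⟩

end TopDyn

theorem mainTheorem11 {X : Type*} [MetricSpace X] [CompactSpace X] [MeasurableSpace X]
    [BorelSpace X] (T : X → X) (hT : Continuous T)
    (happ : TopDyn.ApproximateProductProperty T)
    (hcenter : TopDyn.measureCenter T = Set.univ) :
    ∃ m g : ℝ → X → X → ℕ → ℕ,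
      (∀ ε : ℝ, 0 < ε → ∀ (x y : X) (n : ℕ), 0 < n → g ε x y n ≤ n) ∧
      TopDyn.MGTransitive T m g ∧
      ∀ ε : ℝ, 0 < ε → ∀ x y : X,
        Tendsto (fun n : ℕ => ((m ε x y n : ℝ) + (g ε x y n : ℝ)) / (n : ℝ)) atTop (𝓝 0) := by
  -- Taking the least bound makes `m` and `g` independent of `κ`, so one choice serves every rate.
  refine ⟨fun ε x y n => sInf (TopDyn.gapBounds T ε x y n),
    fun ε x y n => min n (sInf (TopDyn.gapBounds T ε x y n)), fun _ _ _ _ _ _ => min_le_left _ _,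
    ⟨fun ε hε x y => ?_, TopDyn.isTransitive_of_approximateProductProperty happ hcenter⟩,
    fun ε hε x y => ?_⟩
  · obtain ⟨N, hN, h⟩ := TopDyn.eventually_floor_mem_gapBounds happ hcenter hε one_pos x y
    refine ⟨N, hN, fun n hn => ?_⟩
    obtain ⟨z, p, Λ, h1, h2, h3, h4⟩ := Nat.sInf_mem ⟨_, h n hn⟩
    refine ⟨z, p, Λ, h1, h2, le_min ?_ h3, h4⟩
    simpa using Finset.card_le_card (Finset.sdiff_subset (s := Finset.range n) (t := Λ))
  · rw [Metric.tendsto_atTop]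
    intro κ hκ
    have hκ4 : 0 < κ / 4 := by positivity
    obtain ⟨N, hN, h⟩ := TopDyn.eventually_floor_mem_gapBounds happ hcenter hε hκ4 x y
    refine ⟨N, fun n hn => ?_⟩
    have hn0 : (0 : ℝ) < n := by exact_mod_cast hN.trans_le hn
    have h1 : ((sInf (TopDyn.gapBounds T ε x y n) : ℕ) : ℝ) ≤ κ / 4 * n :=
      (Nat.cast_le.2 (Nat.sInf_le (h n hn))).trans (Nat.floor_le (by positivity))
    have h2 : ((min n (sInf (TopDyn.gapBounds T ε x y n)) : ℕ) : ℝ) ≤ κ / 4 * n :=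
      (Nat.cast_le.2 (min_le_right _ _)).trans h1
    rw [Real.dist_eq, sub_zero, abs_of_nonneg (by positivity), div_lt_iff₀ hn0]
    nlinarith [mul_pos hκ hn0]
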